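/- **Definitions.** Let $T$ be a first-order theory in a language $\mathcal L$ and let $\phi(x,y)$ be an $\mathcal L$-formula whose free variables are split into two finite tuples $x$ and $y$. For $k\ge 1$, $\phi(x,y)$ is *$k$-stable in $T$* if $$T\models\neg\exists x_1\ldots x_k\,y_1\ldots y_k\bigwedge_{i,j\le k}\big(\phi(x_i,y_j)\leftrightarrow i\le j\big),$$ and it is *stable in $T$* if it is $k$-stable in $T$ for some $k\ge 1$. The *dual formula* $\phi^*(y,x)$ is $\phi(x,y)$ with the roles of $x$ and $y$ exchanged. Let $M\models T$. A subset of $M^x$ is *$\phi$-definable* if it is defined by a finite Boolean combination of instances $\phi(x,b)$ with $b\in M^y$. A *Keisler $\phi$-measure over $M$* is a finitely additive probability measure on the Boolean algebra of $\phi$-definable subsets of $M^x$. Thus a $\phi^*$-definable set is a subset of $M^y$ defined by a finite Boolean combination of formulas $\phi(a,y)$ with $a\in M^x$, and a Keisler $\phi^*$-measure is a finitely additive probability measure on the Boolean algebra of these sets. Let $\mu$ be a Keisler $\phi$-measure and $\nu$ a Keisler $\phi^*$-measure over $M$. For a $\phi$-definable set $X\subseteq M^x$, a $\phi^*$-definable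 set $Y\subseteq M^y$, $a\in M^x$ and $b\in M^y$, write $\phi(a,Y)=\{b'\in Y: M\models\phi(a,b')\}$ and $\phi(X,b)=\{a'\in X:M\models\phi(a',b)\}$. For $\gamma>0$, the pair $(X,Y)$ is *$\gamma$-special with respect to $\mu$ and $\nu$* if there are a $\phi$-definable set $X'\subseteq X$ and a $\phi^*$-definable set $Y'\subseteq Y$ such that $\mu(X')>(1-\gamma)\mu(X)$, $\nu(Y')>(1-\gamma)\nu(Y)$, and either * for all $a\in X'$ and $b\in Y'$, $\nu(\phi(a,Y))<\gamma\,\nu(Y)$ and $\mu(\phi(X,b))<\gamma\,\mu(X)$, or * for all $a\in X'$ and $b\in Y'$, $\nu(\phi(a,Y))>(1-\gamma)\nu(Y)$ and $\mu(\phi(X,b))>(1-\gamma)\mu(X)$. **Theorem 4.1.** Let $T$ be a first-order $\mathcal L$-theory and let $\phi(x,y)$ be an $\mathcal L$-formula that is stable in $T$. Fix a model $M\models T$, a Keisler $\phi$-measure $\mu$ over $M$, and a Keisler $\phi^*$-measure $\nu$ over $M$. Then for every $\epsilon>0$ there are integers $m,n\ge 1$ such that for every $\gamma>0$ there are partitions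 $$M^x=X_0\cup X_1\cup\dots\cup X_m\qquad\text{and}\qquad M^y=Y_0\cup Y_1\cup\dots\cup Y_n$$ such that each $X_i$ is $\phi$-definable, each $Y_j$ is $\phi^*$-definable, $\mu(X_0)<\epsilon$, $\nu(Y_0)<\epsilon$, and for all $1\le i\le m$ and $1\le j\le n$ the pair $(X_i,Y_j)$ is $\gamma$-special with respect to $\mu$ and $\nu$. (The exceptional sets $X_0$, $Y_0$ may be empty.) -/

import Mathlib

open FirstOrder FirstOrder.Language

namespace StableRegularity

universe u v w u₁ u₂

section

variable {L : FirstOrder.Language.{u, v}} {α : Type u₁} {β : Type u₂}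

/-- The dual formula `φ*(y, x)`: the formula `φ(x, y)` with the roles of the object variables
and the parameter variables exchanged. -/
def dual (φ : L.Formula (α ⊕ β)) : L.Formula (β ⊕ α) :=
  φ.relabel Sum.swap

/-- The formula `φ(xᵢ, yⱼ)` in the variables `x₁, …, x_k, y₁, …, y_k` (tuples of variables). -/
def atIndex (φ : L.Formula (α ⊕ β)) {k : ℕ} (i j : Fin k) :
    L.Formula (Empty ⊕ ((Fin k × α) ⊕ (Fin k × β))) :=
  φ.relabel fun s => Sum.inr (Sum.map (Prod.mk i) (Prod.mk j) s)

/-- The sentence `¬ ∃ x₁ … x_k y₁ … y_k, ⋀_{i,j} (φ(xᵢ, yⱼ) ↔ i ≤ j)`. -/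
noncomputable def noOrderSentence [Finite α] [Finite β] (φ : L.Formula (α ⊕ β)) (k : ℕ) :
    L.Sentence :=
  Formula.not <| Formula.iExs ((Fin k × α) ⊕ (Fin k × β)) <|
    Formula.iInf fun ij : Fin k × Fin k =>
      if ij.1 ≤ ij.2 then atIndex φ ij.1 ij.2 else (atIndex φ ij.1 ij.2).not

/-- `φ(x, y)` is `k`-stable in `T`: the theory `T` proves that there is no `φ`-order of
length `k`. -/
def IsKStable [Finite α] [Finite β] (T : L.Theory) (φ : L.Formula (α ⊕ β)) (k : ℕ) : Prop :=
  T ⊨ᵇ noOrderSentence φ k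

/-- `φ(x, y)` is stable in `T`: it is `k`-stable in `T` for some `k ≥ 1`. -/
def IsStable [Finite α] [Finite β] (T : L.Theory) (φ : L.Formula (α ⊕ β)) : Prop :=
  ∃ k : ℕ, 1 ≤ k ∧ IsKStable T φ k

variable (M : Type w) [L.Structure M]

/-- The subset of `M^x` defined by the instance `φ(x, b)`. -/
def instanceSet (φ : L.Formula (α ⊕ β)) (b : β → M) : Set (α → M) :=
  {a | φ.Realize (Sum.elim a b)}

/-- The Boolean algebra of `φ`-definable subsets of `M^x`: those defined by `φ`-formulas over `M`,
that is, by finite Boolean combinations of instances `φ(x, b)` with `b ∈ M^y`. -/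
def definableSets (φ : L.Formula (α ⊕ β)) : BooleanSubalgebra (Set (α → M)) :=
  BooleanSubalgebra.closure (Set.range (instanceSet M φ))

variable {M}

/-- The instance `φ(x, b)` as a `φ`-definable set. -/
def inst (φ : L.Formula (α ⊕ β)) (b : β → M) : definableSets M φ :=
  ⟨instanceSet M φ b, BooleanSubalgebra.subset_closure ⟨b, rfl⟩⟩

variable (M) in
/-- A Keisler `φ`-measure over `M`: a finitely additive probability measure on the Boolean algebra
of `φ`-formulas over `M`, viewed as a function of the `φ`-definable sets that they define. -/
structure KeislerMeasure (φ : L.Formula (α ⊕ β)) where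
  /-- The value of the measure. -/
  toFun : definableSets M φ → ℝ
  mem_Icc : ∀ X, toFun X ∈ Set.Icc (0 : ℝ) 1
  map_bot : toFun ⊥ = 0
  map_compl : ∀ X, toFun Xᶜ = 1 - toFun X
  map_sup : ∀ X Y, toFun (X ⊔ Y) = toFun X + toFun Y - toFun (X ⊓ Y)

instance (φ : L.Formula (α ⊕ β)) :
    CoeFun (KeislerMeasure M φ) (fun _ => definableSets M φ → ℝ) :=
  ⟨KeislerMeasure.toFun⟩

/-- The pair `(X, Y)` is `γ`-special with respect to `μ` and `ν`. Here `X ⊓ inst φ b` is the set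
`φ(X, b)` of all `a ∈ X` such that `φ(a, b)` holds, and `Y ⊓ inst (dual φ) a` is the set `φ(a, Y)`
of all `b ∈ Y` such that `φ(a, b)` holds. -/
def IsSpecial {φ : L.Formula (α ⊕ β)} (μ : KeislerMeasure M φ) (ν : KeislerMeasure M (dual φ))
    (γ : ℝ) (X : definableSets M φ) (Y : definableSets M (dual φ)) : Prop :=
  ∃ X' : definableSets M φ, ∃ Y' : definableSets M (dual φ),
    X' ≤ X ∧ Y' ≤ Y ∧ (1 - γ) * μ X < μ X' ∧ (1 - γ) * ν Y < ν Y' ∧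
    ((∀ a ∈ (X' : Set (α → M)), ∀ b ∈ (Y' : Set (β → M)),
        ν (Y ⊓ inst (dual φ) a) < γ * ν Y ∧ μ (X ⊓ inst φ b) < γ * μ X) ∨
     (∀ a ∈ (X' : Set (α → M)), ∀ b ∈ (Y' : Set (β → M)),
        (1 - γ) * ν Y < ν (Y ⊓ inst (dual φ) a) ∧ (1 - γ) * μ X < μ (X ⊓ inst φ b)))

/-- The family of sets `P` is a partition of the whole space (members may be empty). -/
def IsPartition {S : Type*} {m : ℕ} (P : Fin (m + 1) → Set S) : Prop :=
  (∀ i j, i ≠ j → Disjoint (P i) (P j)) ∧ ⋃ i, P i = Set.univ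

end

end StableRegularity

/-! Stability forbids half-graphs of some length `k`, and this is used twice. First, it makes each
measure purely atomic on the Stone space of complete types. If the part not carried by points were
nonzero, it would have a positive set that no instance splits into two positive parts, since
otherwise splitting repeatedly builds a half-graph (`exists_unsplit`). Such a set determines a type
whose mass was underestimated (`CompleteType.tsum_weight_eq`). So finitely many types carry all but
`ε` of the mass. Their number depends only on `ε`, while `γ` only governs how tightly disjoint
neighbourhoods enclose them (`exists_types_partition`). Second, for types `p` and `q`, the value of
the relation at the pair is the same computed from either side, and sets in `p` and `q` witness it
(`exists_homogeneous`). Within a tight neighbourhood of a type, every set in the type has almost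
full measure, which gives specialness. -/

namespace StableRegularity

/-! ### Half-graphs and their symmetries. -/

section Ladder

variable {A B : Type*}

/-- `R` has a half-graph of length `k`. -/
def HasLadder (R : A → B → Prop) (k : ℕ) : Prop :=
  ∃ (a : Fin k → A) (b : Fin k → B), ∀ i j, R (a i) (b j) ↔ i ≤ j

theorem HasLadder.swap {R : A → B → Prop} {k : ℕ} (h : HasLadder R k) :
    HasLadder (fun b a => R a b) k := by
  obtain ⟨a, b, hab⟩ := h
  exact ⟨b ∘ Fin.rev, a ∘ Fin.rev, fun i j => by simp [hab, Fin.rev_le_rev]⟩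

/-- Reversing both sequences and shifting one against the other turns `j < i` into `i ≤ j`, at the
cost of one index. -/
theorem hasLadder_of_strict {R : A → B → Prop} {k : ℕ} (a : Fin (k + 1) → A) (b : Fin (k + 1) → B)
    (hab : ∀ i j, R (a i) (b j) ↔ j < i) : HasLadder R k :=
  ⟨fun i => a i.rev.succ, fun j => b j.rev.castSucc, fun i j => by
    rw [hab, Fin.castSucc_lt_succ_iff, Fin.rev_le_rev]⟩

end Ladder

/-! ### Finitely additive functions and their point masses on the Stone space. -/

section FinAdd

variable {𝒜 : Type*} [BooleanAlgebra 𝒜]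

/-- A nonnegative, finitely additive real function on a Boolean algebra. -/
structure IsFinAdd (f : 𝒜 → ℝ) : Prop where
  nonneg : ∀ X, 0 ≤ f X
  split : ∀ X Y, f X = f (X ⊓ Y) + f (X ⊓ Yᶜ)

namespace IsFinAdd

variable {f : 𝒜 → ℝ} (hf : IsFinAdd f)
include hf

theorem bot : f ⊥ = 0 := by
  have := hf.split ⊥ ⊥
  simp at this
  exact this

theorem mono {X Y : 𝒜} (h : X ≤ Y) : f X ≤ f Y := by
  have := hf.split Y X
  rw [inf_eq_right.2 h] at this
  linarith [hf.nonneg (Y ⊓ Xᶜ)]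

theorem sup_of_disjoint {X Y : 𝒜} (h : Disjoint X Y) : f (X ⊔ Y) = f X + f Y := by
  rw [hf.split (X ⊔ Y) X]
  congr 2
  · simp
  · rw [inf_sup_right, inf_compl_self, bot_sup_eq]
    exact inf_eq_left.2 h.symm.le_compl_right

theorem compl (X : 𝒜) : f Xᶜ = f ⊤ - f X := by
  have := hf.split ⊤ X
  simp at this
  linarith

theorem finset_sup {ι : Type*} (s : Finset ι) (X : ι → 𝒜)
    (h : (s : Set ι).PairwiseDisjoint X) : f (s.sup X) = ∑ i ∈ s, f (X i) := by
  classical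
  induction s using Finset.induction_on with
  | empty => simp [hf.bot]
  | insert i s hi ih =>
    rw [Finset.sup_insert, Finset.sum_insert hi, hf.sup_of_disjoint, ih]
    · exact h.subset (by simp)
    · rw [Finset.disjoint_sup_right]
      intro j hj
      exact h (by simp) (by simp [hj]) (by rintro rfl; exact hi hj)

end IsFinAdd

/-- A two-valued homomorphism, that is, an ultrafilter of the Boolean algebra. -/
abbrev CompleteType (𝒜 : Type*) [BooleanAlgebra 𝒜] := BoundedLatticeHom 𝒜 Prop

namespace CompleteType

variable (p : CompleteType 𝒜)

theorem inf_iff {X Y : 𝒜} : p (X ⊓ Y) ↔ p X ∧ p Y := by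
  rw [map_inf]; rfl

theorem compl_iff {X : 𝒜} : p Xᶜ ↔ ¬ p X := by
  rw [map_compl']; rfl

theorem top_mem : p ⊤ := by
  rw [map_top]; trivial

theorem not_bot : ¬ p ⊥ := by
  rw [map_bot]; exact id

theorem mono {X Y : 𝒜} (h : X ≤ Y) (hX : p X) : p Y :=
  OrderHomClass.mono p h hX

theorem finset_inf_iff {ι : Type*} {s : Finset ι} {X : ι → 𝒜} : p (s.inf X) ↔ ∀ i ∈ s, p (X i) := by
  classical
  induction s using Finset.induction_on with
  | empty => simp [p.top_mem]
  | insert i s hi ih => simp only [Finset.inf_insert, inf_iff, ih, Finset.forall_mem_insert]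

theorem exists_separating {p q : CompleteType 𝒜} (h : p ≠ q) : ∃ X, p X ∧ ¬ q X := by
  by_contra! H
  refine h (DFunLike.ext _ _ fun X => propext ⟨H X, fun hq => ?_⟩)
  by_contra hp
  exact (q.compl_iff.1 (H _ (p.compl_iff.2 hp))) hq

/-- The Hausdorff property of the Stone space, for finitely many points at once. -/
theorem exists_pairwiseDisjoint {s : Finset (CompleteType 𝒜)} :
    ∃ Z : CompleteType 𝒜 → 𝒜, (∀ p ∈ s, p (Z p)) ∧ (s : Set (CompleteType 𝒜)).PairwiseDisjoint Z := by
  classical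
  have H : ∀ p q : CompleteType 𝒜, ∃ X, p ≠ q → p X ∧ ¬ q X := fun p q => by
    by_cases h : p = q
    · exact ⟨⊤, fun h' => (h' h).elim⟩
    · exact (exists_separating h).imp fun X hX _ => hX
  choose D hD using H
  refine ⟨fun p => (s.erase p).inf fun q => D p q ⊓ (D q p)ᶜ, fun p _ => ?_, fun p hp q hq hpq => ?_⟩
  · rw [finset_inf_iff]
    intro q hq
    have hne : p ≠ q := (Finset.ne_of_mem_erase hq).symm
    rw [inf_iff, compl_iff]
    exact ⟨(hD p q hne).1, (hD q p hne.symm).2⟩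
  · have h1 : ((s.erase p).inf fun q => D p q ⊓ (D q p)ᶜ) ≤ D p q :=
      (Finset.inf_le (Finset.mem_erase.2 ⟨hpq.symm, hq⟩)).trans inf_le_left
    have h2 : ((s.erase q).inf fun r => D q r ⊓ (D r q)ᶜ) ≤ (D p q)ᶜ :=
      (Finset.inf_le (Finset.mem_erase.2 ⟨hpq, hp⟩)).trans inf_le_right
    exact disjoint_compl_right.mono h1 h2

/-- The mass that `f` gives to the point `p` of the Stone space. -/
noncomputable def weight (f : 𝒜 → ℝ) (p : CompleteType 𝒜) : ℝ := ⨅ Z : {Z // p Z}, f Z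

variable {f : 𝒜 → ℝ} (hf : IsFinAdd f) {p : CompleteType 𝒜}
include hf

theorem weight_le {Z : 𝒜} (hZ : p Z) : weight f p ≤ f Z :=
  ciInf_le (f := fun Z : {Z // p Z} => f Z)
    ⟨0, by rintro _ ⟨Z, rfl⟩; exact hf.nonneg _⟩ ⟨Z, hZ⟩

omit hf in
theorem le_weight {c : ℝ} (h : ∀ Z, p Z → c ≤ f Z) : c ≤ weight f p :=
  haveI : Nonempty {Z // p Z} := ⟨⟨⊤, p.top_mem⟩⟩
  le_ciInf fun Z => h Z Z.2

theorem weight_nonneg : 0 ≤ weight f p := le_weight fun _ _ => hf.nonneg _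

theorem sum_weight_le (s : Finset (CompleteType 𝒜)) (X : 𝒜) (hs : ∀ p ∈ s, p X) :
    ∑ p ∈ s, weight f p ≤ f X := by
  obtain ⟨Z, hZ, hd⟩ := exists_pairwiseDisjoint (s := s)
  calc ∑ p ∈ s, weight f p ≤ ∑ p ∈ s, f (X ⊓ Z p) :=
        Finset.sum_le_sum fun p hp => weight_le hf (p.inf_iff.2 ⟨hs p hp, hZ p hp⟩)
    _ = f (s.sup fun p => X ⊓ Z p) :=
        (hf.finset_sup s _ (hd.mono fun _ => inf_le_right)).symm
    _ ≤ f X := hf.mono (Finset.sup_le fun _ _ => inf_le_left)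

theorem summable_weight : Summable (weight f) :=
  summable_of_sum_le (fun _ => weight_nonneg hf) fun s => sum_weight_le hf s ⊤ fun p _ => p.top_mem

theorem summable_indicator_weight (X : 𝒜) :
    Summable ({p : CompleteType 𝒜 | p X}.indicator (weight f)) :=
  (summable_weight hf).indicator _

/-- The part of a finitely additive function not carried by points of the Stone space. -/
theorem isFinAdd_defect :
    IsFinAdd fun X => f X - ∑' p, {p : CompleteType 𝒜 | p X}.indicator (weight f) p where
  nonneg X := by
    classical
    refine sub_nonneg.2 (Real.tsum_le_of_sum_le
      (fun p => Set.indicator_nonneg (fun p _ => weight_nonneg hf) p) fun s => ?_)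
    have : ∑ p ∈ s, {p : CompleteType 𝒜 | p X}.indicator (weight f) p =
        ∑ p ∈ s with p X, weight f p := by
      rw [Finset.sum_filter]
      exact Finset.sum_congr rfl fun p _ => by simp [Set.indicator_apply]
    rw [this]
    exact sum_weight_le hf _ X fun p hp => (Finset.mem_filter.1 hp).2
  split X Y := by
    have : ∑' p, {p : CompleteType 𝒜 | p X}.indicator (weight f) p =
        ∑' p, {p : CompleteType 𝒜 | p (X ⊓ Y)}.indicator (weight f) p +
        ∑' p, {p : CompleteType 𝒜 | p (X ⊓ Yᶜ)}.indicator (weight f) p := by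
      rw [← (summable_indicator_weight hf _).tsum_add (summable_indicator_weight hf _)]
      refine tsum_congr fun p => ?_
      by_cases hX : p X <;> by_cases hY : p Y <;>
        simp [Set.indicator_apply, inf_iff, compl_iff, hX, hY, -map_inf]
    rw [this, hf.split X Y]
    ring

/-- If every nonzero finitely additive function has a two-valued restriction, then `f` is carried by
the points of the Stone space. -/
theorem tsum_weight_eq
    (H : ∀ g : 𝒜 → ℝ, IsFinAdd g → 0 < g ⊤ → ∃ X, 0 < g X ∧ ∀ Z, g (X ⊓ Z) = 0 ∨ g (X ⊓ Zᶜ) = 0) :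
    ∑' p, weight f p = f ⊤ := by
  set g : 𝒜 → ℝ := fun X => f X - ∑' p, {p : CompleteType 𝒜 | p X}.indicator (weight f) p with hg
  have hgf : IsFinAdd g := isFinAdd_defect hf
  have htop : g ⊤ = f ⊤ - ∑' p, weight f p := by
    simp only [hg]
    congr 1
    exact tsum_congr fun p => Set.indicator_of_mem (by exact p.top_mem) _
  by_contra hne
  have hpos : 0 < g ⊤ := lt_of_le_of_ne (hgf.nonneg _) fun h => hne (by linarith)
  obtain ⟨X, hX, hZ⟩ := H g hgf hpos
  have key : ∀ Z, (¬ 0 < g (X ⊓ Z)) ↔ 0 < g (X ⊓ Zᶜ) := fun Z => by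
    have := hgf.split X Z
    rcases hZ Z with h | h
    · simp [h] at this ⊢; linarith
    · simp [h] at this ⊢; linarith
  have hmono : ∀ Z W, Z ≤ W → 0 < g (X ⊓ Z) → 0 < g (X ⊓ W) := fun Z W h h0 =>
    h0.trans_le (hgf.mono (inf_le_inf_left X h))
  have hinf : ∀ Z W, 0 < g (X ⊓ Z) → 0 < g (X ⊓ W) → 0 < g (X ⊓ (Z ⊓ W)) := fun Z W h1 h2 => by
    have e1 : g (X ⊓ Wᶜ) ≤ 0 := not_lt.1 fun h => ((key W).2 h) h2
    have e2 := hgf.split (X ⊓ Z) W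
    have e3 : g (X ⊓ Z ⊓ Wᶜ) ≤ g (X ⊓ Wᶜ) := hgf.mono (inf_le_inf_right _ inf_le_left)
    rw [← inf_assoc]
    linarith
  -- Since `g` is two-valued below `X`, being positive there is an ultrafilter.
  let p : CompleteType 𝒜 :=
    { toFun := fun Z => 0 < g (X ⊓ Z)
      map_sup' := fun Z W => propext ⟨fun h => by
          by_contra hc
          have hc' := not_or.1 hc
          have := hinf _ _ ((key Z).1 hc'.1) ((key W).1 hc'.2)
          rw [← compl_sup] at this
          exact ((key _).2 this) h,
        fun h => h.elim (hmono _ _ le_sup_left) (hmono _ _ le_sup_right)⟩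
      map_inf' := fun Z W => propext ⟨fun h => ⟨hmono _ _ inf_le_left h, hmono _ _ inf_le_right h⟩,
        fun h => hinf _ _ h.1 h.2⟩
      map_top' := by simpa using hX
      map_bot' := by simp [hgf.bot] }
  -- Each `Z` in `p` has defect at least `g X` and point part at least the weight of `p`. Taking the
  -- infimum over `Z` makes the weight exceed itself.
  have hw : g X + weight f p ≤ weight f p := by
    refine le_weight fun Z hpZ => ?_
    have h1 : g (X ⊓ Z) = g X := by
      have := hgf.split X Z
      rcases hZ Z with h | h
      · exact absurd hpZ (by change ¬ 0 < g (X ⊓ Z); simp [h])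
      · linarith
    have h2 : g X ≤ g Z := h1 ▸ hgf.mono inf_le_right
    have h3 : weight f p ≤ ∑' q, {q : CompleteType 𝒜 | q Z}.indicator (weight f) q := by
      have := (summable_indicator_weight hf Z).le_tsum p
        fun q _ => Set.indicator_nonneg (fun p _ => weight_nonneg hf) q
      rwa [Set.indicator_of_mem (by exact hpZ)] at this
    simp only [hg] at h2 ⊢
    linarith
  linarith

end CompleteType

end FinAdd

/-! ### Homogeneity of a stable relation on a pair of types. -/

section Homogeneous

variable {A B : Type*}

/-- Extend greedily: the new `a'` is unrelated to all earlier `b`, then the new `b'` is related to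
every `a`, including `a'`. -/
theorem exists_ladder_of_extend {R : A → B → Prop} {S : Set A} {T : Set B}
    (hS : ∀ t : Finset B, (t : Set B) ⊆ T → ∃ a ∈ S, ∀ b ∈ t, ¬ R a b)
    (hT : ∀ s : Finset A, (s : Set A) ⊆ S → ∃ b ∈ T, ∀ a ∈ s, R a b) (k : ℕ) :
    ∃ (a : Fin k → A) (b : Fin k → B),
      (∀ i, a i ∈ S) ∧ (∀ j, b j ∈ T) ∧ ∀ i j, R (a i) (b j) ↔ i ≤ j := by
  classical
  induction k with
  | zero => exact ⟨Fin.elim0, Fin.elim0, fun i => i.elim0, fun i => i.elim0, fun i => i.elim0⟩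
  | succ k ih =>
    obtain ⟨a, b, ha, hb, hab⟩ := ih
    obtain ⟨a', ha', hr⟩ := hS (Finset.univ.image b) (by simpa [Set.range_subset_iff] using hb)
    obtain ⟨b', hb', hr'⟩ := hT (insert a' (Finset.univ.image a))
      (by simpa [Set.insert_subset_iff, Set.range_subset_iff] using ⟨ha', ha⟩)
    refine ⟨Fin.snoc (α := fun _ => A) a a', Fin.snoc (α := fun _ => B) b b', ?_, ?_, ?_⟩
    · intro i
      cases i using Fin.lastCases <;> simp [ha, ha']
    · intro i
      cases i using Fin.lastCases <;> simp [hb, hb']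
    · intro i j
      cases i using Fin.lastCases with
      | last =>
        cases j using Fin.lastCases with
        | last => simpa using hr' a' (by simp)
        | cast j => simpa using hr (b j) (by simp)
      | cast i =>
        cases j using Fin.lastCases with
        | last => simpa [Fin.le_last] using hr' (a i) (by simp)
        | cast j => simpa using hab i j

theorem CompleteType.exists_mem {𝒜 : BooleanSubalgebra (Set A)} (p : CompleteType 𝒜) {X : 𝒜}
    (hX : p X) : ∃ a, a ∈ (X : Set A) := by
  by_contra! h
  have : X = ⊥ := Subtype.ext (Set.eq_empty_of_forall_notMem h)
  exact p.not_bot (this ▸ hX)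

variable {𝒜 : BooleanSubalgebra (Set A)} {ℬ : BooleanSubalgebra (Set B)} {k : ℕ}

/-- If both alternatives fail, every set in `p` has a point `a` with `q (G a)`, and every set in `q`
has a point `b` with `¬ p (F b)`. Finite intersections of the sets `(F b)ᶜ` and `G a` then feed the
greedy construction of a ladder. -/
theorem forall_not_mem_or_forall_mem {R : A → B → Prop} (hR : ¬ HasLadder R k)
    {F : B → 𝒜} {G : A → ℬ} (hF : ∀ a b, a ∈ (F b : Set A) ↔ R a b)
    (hG : ∀ a b, b ∈ (G a : Set B) ↔ R a b) (p : CompleteType 𝒜) (q : CompleteType ℬ) :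
    (∃ X : 𝒜, p X ∧ ∀ a ∈ (X : Set A), ¬ q (G a)) ∨
      (∃ Y : ℬ, q Y ∧ ∀ b ∈ (Y : Set B), p (F b)) := by
  by_contra! h
  obtain ⟨h1, h2⟩ := h
  obtain ⟨a, b, -, -, hab⟩ := exists_ladder_of_extend (R := R) (S := {a | q (G a)})
    (T := {b | ¬ p (F b)}) (fun t ht => by
      obtain ⟨a, ha, hq⟩ := h1 (t.inf fun b => (F b)ᶜ)
        (p.finset_inf_iff.2 fun b hb => p.compl_iff.2 (ht hb))
      refine ⟨a, hq, fun b hb hr => ?_⟩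
      have : a ∈ (((F b)ᶜ : 𝒜) : Set A) := (Finset.inf_le (f := fun b => (F b)ᶜ) hb) ha
      exact this ((hF a b).2 hr))
    (fun s hs => by
      obtain ⟨b, hb, hq⟩ := h2 (s.inf G) (q.finset_inf_iff.2 fun a ha => hs ha)
      exact ⟨b, hq, fun a ha => (hG a b).1 ((Finset.inf_le (f := G) ha) hb)⟩) k
  exact hR ⟨a, b, hab⟩

/-- Two complete types of a stable relation have representatives on which the relation is
homogeneous in the sense of both types. -/
theorem exists_homogeneous {R : A → B → Prop} (hR : ¬ HasLadder R k)
    {F : B → 𝒜} {G : A → ℬ} (hF : ∀ a b, a ∈ (F b : Set A) ↔ R a b)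
    (hG : ∀ a b, b ∈ (G a : Set B) ↔ R a b) (p : CompleteType 𝒜) (q : CompleteType ℬ) :
    ∃ (X : 𝒜) (Y : ℬ), p X ∧ q Y ∧
      (((∀ a ∈ (X : Set A), ¬ q (G a)) ∧ ∀ b ∈ (Y : Set B), ¬ p (F b)) ∨
        ((∀ a ∈ (X : Set A), q (G a)) ∧ ∀ b ∈ (Y : Set B), p (F b))) := by
  have hR' : ¬ HasLadder (fun b a => R a b) k := fun h => hR h.swap
  -- The dichotomy is applied from both sides. Mixed outcomes conflict at a common point of two sets
  -- of the same type.
  rcases forall_not_mem_or_forall_mem hR hF hG p q with ⟨X, hX, h1⟩ | ⟨Y, hY, h1⟩ <;>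
    rcases forall_not_mem_or_forall_mem hR' (fun b a => hG a b) (fun b a => hF a b) q p with
      ⟨Y', hY', h2⟩ | ⟨X', hX', h2⟩
  · exact ⟨X, Y', hX, hY', Or.inl ⟨h1, h2⟩⟩
  · obtain ⟨a, ha⟩ := p.exists_mem (p.inf_iff.2 ⟨hX, hX'⟩)
    exact absurd (h2 a ha.2) (h1 a ha.1)
  · obtain ⟨b, hb⟩ := q.exists_mem (q.inf_iff.2 ⟨hY, hY'⟩)
    exact absurd (h1 b hb.1) (h2 b hb.2)
  · exact ⟨X', Y, hX', hY, Or.inr ⟨h2, h1⟩⟩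

end Homogeneous

/-! ### Positive sets that no instance splits. -/

section Atoms

variable {A B : Type*} {𝒜 : BooleanSubalgebra (Set A)} {R : A → B → Prop} {F : B → 𝒜}
  {f : 𝒜 → ℝ}

/-- If every positive set below `X` is split into two positive parts by some `F b` with `b ∈ T`, then
there are long ladders of one of the two kinds. -/
theorem exists_ladder_or_strict_ladder (hF : ∀ a b, a ∈ (F b : Set A) ↔ R a b) (hf : IsFinAdd f)
    (r s : ℕ) (X : 𝒜) (T : Set B) (hX : 0 < f X)
    (hT : ∀ Z ≤ X, 0 < f Z → ∃ b ∈ T, 0 < f (Z ⊓ F b) ∧ 0 < f (Z ⊓ (F b)ᶜ)) :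
    (∃ (a : Fin r → A) (b : Fin r → B), (∀ i, a i ∈ (X : Set A)) ∧ (∀ j, b j ∈ T) ∧
      ∀ i j, R (a i) (b j) ↔ i ≤ j) ∨
    (∃ (a : Fin s → A) (b : Fin s → B), (∀ i, a i ∈ (X : Set A)) ∧ (∀ j, b j ∈ T) ∧
      ∀ i j, R (a i) (b j) ↔ j < i) := by
  induction r generalizing s X T with
  | zero => exact Or.inl ⟨Fin.elim0, Fin.elim0, fun i => i.elim0, fun i => i.elim0, fun i => i.elim0⟩
  | succ r ihr =>
  induction s generalizing X T with
  | zero => exact Or.inr ⟨Fin.elim0, Fin.elim0, fun i => i.elim0, fun i => i.elim0, fun i => i.elim0⟩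
  | succ s ihs =>
  obtain ⟨a₀, ha₀⟩ : ∃ a, a ∈ (X : Set A) := by
    by_contra! h
    have : X = ⊥ := Subtype.ext (Set.eq_empty_of_forall_notMem h)
    rw [this, hf.bot] at hX
    exact hX.false
  -- Either splitters related to `a₀` suffice everywhere below `X`, and `a₀` starts a ladder of the
  -- first kind. Or below some positive `Z` all splitters are unrelated to `a₀`, and it starts one
  -- of the second kind. The two cases lower `r` and `s` respectively.
  by_cases hred : ∀ Z ≤ X, 0 < f Z →
      ∃ b ∈ {b ∈ T | R a₀ b}, 0 < f (Z ⊓ F b) ∧ 0 < f (Z ⊓ (F b)ᶜ)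
  · obtain ⟨b₀, ⟨hb₀, hr₀⟩, -, h0⟩ := hred X le_rfl hX
    have hle : X ⊓ (F b₀)ᶜ ≤ X := inf_le_left
    rcases ihr (s + 1) (X ⊓ (F b₀)ᶜ) {b ∈ T | R a₀ b} h0 (fun Z hZ => hred Z (hZ.trans hle)) with
      ⟨a, b, ha, hb, hab⟩ | ⟨a, b, ha, hb, hab⟩
    · refine Or.inl ⟨Fin.cons a₀ a, Fin.cons b₀ b, ?_, ?_, ?_⟩
      · intro i
        cases i using Fin.cases with
        | zero => exact ha₀
        | succ i => exact hle (ha i)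
      · intro i
        cases i using Fin.cases with
        | zero => exact hb₀
        | succ i => exact (hb i).1
      · intro i j
        cases i using Fin.cases with
        | zero =>
          cases j using Fin.cases with
          | zero => simpa using hr₀
          | succ j => simpa using (hb j).2
        | succ i =>
          cases j using Fin.cases with
          | zero => simpa [← hF] using (ha i).2
          | succ j => simpa using hab i j
    · exact Or.inr ⟨a, b, fun i => hle (ha i), fun j => (hb j).1, hab⟩
  · push Not at hred
    obtain ⟨Z, hZX, hZ, hno⟩ := hred
    have hblue : ∀ W ≤ Z, 0 < f W →
        ∃ b ∈ {b ∈ T | ¬ R a₀ b}, 0 < f (W ⊓ F b) ∧ 0 < f (W ⊓ (F b)ᶜ) := fun W hW hW0 => by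
      obtain ⟨b, hb, h1, h2⟩ := hT W (hW.trans hZX) hW0
      refine ⟨b, ⟨hb, fun hr => ?_⟩, h1, h2⟩
      have h3 := hno b ⟨hb, hr⟩ (h1.trans_le (hf.mono (inf_le_inf_right _ hW)))
      have h4 := hf.mono (inf_le_inf_right (F b)ᶜ hW)
      linarith
    obtain ⟨b₀, ⟨hb₀, hr₀⟩, h0, -⟩ := hblue Z le_rfl hZ
    have hle : Z ⊓ F b₀ ≤ X := inf_le_left.trans hZX
    rcases ihs (Z ⊓ F b₀) {b ∈ T | ¬ R a₀ b} h0 (fun W hW => hblue W (hW.trans inf_le_left)) with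
      ⟨a, b, ha, hb, hab⟩ | ⟨a, b, ha, hb, hab⟩
    · exact Or.inl ⟨a, b, fun i => hle (ha i), fun j => (hb j).1, hab⟩
    · refine Or.inr ⟨Fin.cons a₀ a, Fin.cons b₀ b, ?_, ?_, ?_⟩
      · intro i
        cases i using Fin.cases with
        | zero => exact ha₀
        | succ i => exact hle (ha i)
      · intro i
        cases i using Fin.cases with
        | zero => exact hb₀
        | succ i => exact (hb i).1
      · intro i j
        cases i using Fin.cases with
        | zero =>
          cases j using Fin.cases with
          | zero => simpa using hr₀
          | succ j => simpa using (hb j).2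
        | succ i =>
          cases j using Fin.cases with
          | zero => simpa [← hF] using (ha i).2
          | succ j => simpa using hab i j

theorem exists_unsplit {k : ℕ} (hR : ¬ HasLadder R k) (hF : ∀ a b, a ∈ (F b : Set A) ↔ R a b)
    (hf : IsFinAdd f) (h0 : 0 < f ⊤) :
    ∃ X, 0 < f X ∧ ∀ b, f (X ⊓ F b) = 0 ∨ f (X ⊓ (F b)ᶜ) = 0 := by
  by_contra! H
  -- The strict ladder needs length `k + 1` because converting it loses one index.
  rcases exists_ladder_or_strict_ladder hF hf k (k + 1) ⊤ Set.univ h0 (fun Z _ hZ => by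
    obtain ⟨b, h1, h2⟩ := H Z hZ
    exact ⟨b, trivial, (hf.nonneg _).lt_of_ne' h1, (hf.nonneg _).lt_of_ne' h2⟩) with
    ⟨a, b, -, -, hab⟩ | ⟨a, b, -, -, hab⟩
  · exact hR ⟨a, b, hab⟩
  · exact hR (hasLadder_of_strict a b hab)

/-- The sets that fail to split `X` are closed under complements and unions, so checking generators
suffices. -/
theorem IsFinAdd.two_valued_of_closure {s : Set (Set A)} {f : BooleanSubalgebra.closure s → ℝ}
    (hf : IsFinAdd f) {X : BooleanSubalgebra.closure s}
    (h : ∀ (Z : Set A) (hZ : Z ∈ s), f (X ⊓ ⟨Z, BooleanSubalgebra.subset_closure hZ⟩) = 0 ∨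
      f (X ⊓ ⟨Z, BooleanSubalgebra.subset_closure hZ⟩ᶜ) = 0)
    (Z : BooleanSubalgebra.closure s) : f (X ⊓ Z) = 0 ∨ f (X ⊓ Zᶜ) = 0 := by
  have hzero : ∀ {U V : BooleanSubalgebra.closure s}, U ≤ V → f V = 0 → f U = 0 :=
    fun hUV hV => le_antisymm (hV ▸ hf.mono hUV) (hf.nonneg _)
  obtain ⟨Z, hZ⟩ := Z
  induction hZ using BooleanSubalgebra.closure_bot_sup_induction with
  | mem Z hZ => exact h Z hZ
  | bot =>
    left
    exact hzero (inf_le_right) hf.bot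
  | sup Y hY Z hZ ihY ihZ =>
    change f (X ⊓ (⟨Y, hY⟩ ⊔ ⟨Z, hZ⟩)) = 0 ∨ f (X ⊓ (⟨Y, hY⟩ ⊔ ⟨Z, hZ⟩)ᶜ) = 0
    rcases ihY with h1 | h1
    · rcases ihZ with h2 | h2
      · left
        have h3 := hf.split (X ⊓ (⟨Y, hY⟩ ⊔ ⟨Z, hZ⟩)) ⟨Y, hY⟩
        rw [h3, hzero (inf_le_inf_right _ inf_le_left) h1, hzero _ h2, add_zero]
        rw [inf_assoc, inf_sup_right, inf_compl_self, bot_sup_eq]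
        exact inf_le_inf_left _ inf_le_left
      · right
        exact hzero (inf_le_inf_left _ (compl_le_compl le_sup_right)) h2
    · right
      exact hzero (inf_le_inf_left _ (compl_le_compl le_sup_left)) h1
  | compl Z hZ ih =>
    change f (X ⊓ ⟨Z, hZ⟩ᶜ) = 0 ∨ f (X ⊓ ⟨Z, hZ⟩ᶜᶜ) = 0
    rw [compl_compl]
    exact ih.symm

end Atoms

/-! ### Partitions around finitely many heavy types. -/

section Partition

variable {A : Type*} {𝒜 : BooleanSubalgebra (Set A)} {f : 𝒜 → ℝ}

open StableRegularity.CompleteType in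
theorem exists_types_partition (hf : IsFinAdd f) (h1 : f ⊤ = 1)
    (hsum : ∑' p : CompleteType 𝒜, weight f p = 1) {ε : ℝ} (hε : 0 < ε) :
    ∃ (m : ℕ) (p : Fin m → CompleteType 𝒜), 1 ≤ m ∧
      ∀ γ : ℝ, 0 < γ → ∃ X : Fin (m + 1) → 𝒜, IsPartition (fun i => (X i : Set A)) ∧ f (X 0) < ε ∧
        ∀ i, p i (X i.succ) ∧ f (X i.succ) < (1 + γ) * weight f (p i) := by
  classical
  -- The cap at `1` keeps the sum positive, hence the family nonempty, even for large `ε`.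
  obtain ⟨s, hs⟩ : ∃ s : Finset (CompleteType 𝒜), 1 - min ε 1 < ∑ p ∈ s, weight f p := by
    refine ((summable_weight hf).hasSum.eventually (lt_mem_nhds ?_)).exists
    rw [hsum]
    linarith [lt_min hε one_pos]
  obtain ⟨t, ht, htpos⟩ : ∃ t : Finset (CompleteType 𝒜), 1 - min ε 1 < ∑ p ∈ t, weight f p ∧
      ∀ p ∈ t, 0 < weight f p :=
    ⟨s.filter fun p => weight f p ≠ 0, by rwa [Finset.sum_filter_ne_zero], fun p hp =>
      (weight_nonneg hf).lt_of_ne' (Finset.mem_filter.1 hp).2⟩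
  have htne : t.Nonempty := by
    rw [Finset.nonempty_iff_ne_empty]
    rintro rfl
    simp only [Finset.sum_empty] at ht
    linarith [min_le_right ε 1]
  let e := t.equivFin.symm
  refine ⟨t.card, fun i => (e i : CompleteType 𝒜), htne.card_pos, fun γ hγ => ?_⟩
  obtain ⟨Z, hZ, hZd⟩ := exists_pairwiseDisjoint (s := t)
  -- The weight is a positive infimum, so some set in the type comes within the factor `1 + γ` of
  -- it.
  have hW : ∀ p : CompleteType 𝒜, ∃ W, p ∈ t → p W ∧ f W < (1 + γ) * weight f p := fun p => by
    by_contra! H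
    have hp := (H ⊤).1
    have : (1 + γ) * weight f p ≤ weight f p := le_weight fun W hW => (H W).2 hW
    nlinarith [mul_pos hγ (htpos p hp)]
  choose W hW using hW
  let U : Fin t.card → 𝒜 := fun i => Z (e i) ⊓ W (e i)
  have hUd : Pairwise (Function.onFun Disjoint U) := fun i j hij =>
    (hZd (e i).2 (e j).2 fun h => hij (e.injective (Subtype.ext h))).mono inf_le_left inf_le_left
  have hU : ∀ i, (e i : CompleteType 𝒜) (U i) := fun i =>
    (inf_iff _).2 ⟨hZ _ (e i).2, (hW _ (e i).2).1⟩
  refine ⟨Fin.cons (Finset.univ.sup U)ᶜ U, ⟨?_, ?_⟩, ?_, fun i => ⟨hU i, ?_⟩⟩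
  · have hdisj : ∀ {P Q : 𝒜}, Disjoint P Q → Disjoint (P : Set A) (Q : Set A) := fun {P Q} h => by
      have := congrArg (Subtype.val) h.eq_bot
      exact disjoint_iff.2 this
    have hzero : ∀ j, Disjoint (Finset.univ.sup U)ᶜ (U j) := fun j =>
      disjoint_compl_left.mono_right (Finset.le_sup (Finset.mem_univ j))
    intro i j hij
    refine hdisj ?_
    cases i using Fin.cases with
    | zero =>
      cases j using Fin.cases with
      | zero => exact absurd rfl hij
      | succ j => exact hzero j
    | succ i =>
      cases j using Fin.cases with
      | zero => exact (hzero i).symm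
      | succ j => exact hUd fun h => hij (congrArg _ h)
  · set X : Fin (t.card + 1) → 𝒜 := Fin.cons (Finset.univ.sup U)ᶜ U
    refine Set.eq_univ_of_forall fun a => ?_
    by_contra ha
    rw [Set.mem_iUnion, not_exists] at ha
    refine ha 0 fun haU => ?_
    have hval : ∀ s : Finset (Fin t.card), a ∉ ((s.sup U : 𝒜) : Set A) := fun s => by
      induction s using Finset.induction_on with
      | empty => exact id
      | insert i s _ ih =>
        rw [Finset.sup_insert]
        exact fun h => h.elim (ha i.succ) ih
    exact hval _ haU
  · have h2 : f (Finset.univ.sup U) = ∑ i, f (U i) :=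
      hf.finset_sup _ _ fun i _ j _ hij => hUd hij
    have h3 : ∑ p ∈ t, weight f p = ∑ i, weight f (e i : CompleteType 𝒜) := by
      rw [← Finset.sum_coe_sort]
      exact (e.sum_comp fun p : t => weight f (p : CompleteType 𝒜)).symm
    have h4 : ∑ i, weight f (e i : CompleteType 𝒜) ≤ ∑ i, f (U i) :=
      Finset.sum_le_sum fun i _ => weight_le hf (hU i)
    rw [Fin.cons_zero, hf.compl, h1, h2]
    linarith [min_le_left ε 1]
  · exact (hf.mono inf_le_right).trans_lt (hW _ (e i).2).2

end Partition

/-! ### Application to Keisler measures. -/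

section Keisler

variable {L : FirstOrder.Language} {α β : Type*} {M : Type*} [L.Structure M]

theorem KeislerMeasure.isFinAdd {φ : L.Formula (α ⊕ β)} (μ : KeislerMeasure M φ) : IsFinAdd μ where
  nonneg X := (μ.mem_Icc X).1
  split X Y := by
    have h := μ.map_sup (X ⊓ Y) (X ⊓ Yᶜ)
    rw [← inf_sup_left, sup_compl_eq_top, inf_top_eq] at h
    rw [h, ← inf_inf_distrib_left, inf_compl_self, inf_bot_eq, μ.map_bot, sub_zero]

theorem KeislerMeasure.map_top {φ : L.Formula (α ⊕ β)} (μ : KeislerMeasure M φ) : μ ⊤ = 1 := by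
  have h := μ.map_compl ⊥
  rw [compl_bot, μ.map_bot] at h
  linarith

variable (M) in
/-- The relation between `M^x` and `M^y` defined by `φ`. -/
def relation (φ : L.Formula (α ⊕ β)) (a : α → M) (b : β → M) : Prop := φ.Realize (Sum.elim a b)

theorem relation_dual (φ : L.Formula (α ⊕ β)) :
    relation M (dual φ) = fun b a => relation M φ a b := by
  funext b a
  simp only [relation, dual, Formula.realize_relabel, eq_iff_iff]
  refine iff_of_eq (congrArg _ (funext fun s => ?_))
  cases s <;> rfl

theorem exists_not_hasLadder [Finite α] [Finite β] [Nonempty M] {T : L.Theory}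
    {φ : L.Formula (α ⊕ β)} (hφ : IsStable T φ) (hM : M ⊨ T) :
    ∃ k, ¬ HasLadder (relation M φ) k := by
  obtain ⟨k, -, hk⟩ := hφ
  refine ⟨k, ?_⟩
  rintro ⟨a, b, hab⟩
  have h : M ⊨ noOrderSentence φ k := hk.realize_sentence M
  simp only [noOrderSentence, Sentence.Realize, Formula.realize_not, Formula.realize_iExs,
    Formula.realize_iInf] at h
  refine h ⟨Sum.elim (fun s => a s.1 s.2) (fun s => b s.1 s.2), fun ij => ?_⟩
  have key : (atIndex φ ij.1 ij.2).Realize (Sum.elim default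
      (Sum.elim (fun s => a s.1 s.2) (fun s => b s.1 s.2))) ↔ relation M φ (a ij.1) (b ij.2) := by
    rw [atIndex, Formula.realize_relabel, relation]
    refine iff_of_eq (congrArg _ (funext fun s => ?_))
    cases s <;> rfl
  split_ifs with hij
  · exact key.2 ((hab _ _).2 hij)
  · rw [Formula.realize_not]
    exact fun h => hij ((hab _ _).1 (key.1 h))

theorem KeislerMeasure.tsum_weight {φ : L.Formula (α ⊕ β)} {k : ℕ}
    (hφ : ¬ HasLadder (relation M φ) k) (μ : KeislerMeasure M φ) :
    ∑' p, CompleteType.weight μ p = 1 := by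
  rw [← μ.map_top]
  refine CompleteType.tsum_weight_eq μ.isFinAdd fun g hg h0 => ?_
  obtain ⟨X, hX, hs⟩ := exists_unsplit (F := inst φ) hφ (fun a b => Iff.rfl) hg h0
  refine ⟨X, hX, fun Z => hg.two_valued_of_closure ?_ Z⟩
  rintro _ ⟨b, rfl⟩
  exact hs b

/-- With `w` the weight of `p`, `f X - w < γ * w ≤ γ * f X`, while `w ≤ f Z`; no bound `γ < 1` is
needed. -/
theorem IsFinAdd.lt_mul_of_mem {𝒜 : Type*} [BooleanAlgebra 𝒜] {f : 𝒜 → ℝ} (hf : IsFinAdd f)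
    {p : CompleteType 𝒜} {γ : ℝ} (hγ : 0 < γ) {X Z : 𝒜} (hX : p X)
    (hlt : f X < (1 + γ) * CompleteType.weight f p) (hZ : p Z) : (1 - γ) * f X < f Z := by
  have h1 := CompleteType.weight_le hf hX
  have h2 := CompleteType.weight_le hf hZ
  nlinarith

theorem IsFinAdd.lt_mul_of_not_mem {𝒜 : Type*} [BooleanAlgebra 𝒜] {f : 𝒜 → ℝ} (hf : IsFinAdd f)
    {p : CompleteType 𝒜} {γ : ℝ} (hγ : 0 < γ) {X Z : 𝒜} (hX : p X)
    (hlt : f X < (1 + γ) * CompleteType.weight f p) (hZ : ¬ p Z) : f (X ⊓ Z) < γ * f X := by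
  have h1 := hf.lt_mul_of_mem hγ hX hlt (p.inf_iff.2 ⟨hX, p.compl_iff.2 hZ⟩)
  have h2 := hf.split X Z
  linarith

theorem isSpecial_of_types {φ : L.Formula (α ⊕ β)} {k : ℕ} (hφ : ¬ HasLadder (relation M φ) k)
    (μ : KeislerMeasure M φ) (ν : KeislerMeasure M (dual φ)) {γ : ℝ} (hγ : 0 < γ)
    {p : CompleteType (definableSets M φ)} {q : CompleteType (definableSets M (dual φ))}
    {X : definableSets M φ} {Y : definableSets M (dual φ)} (hX : p X) (hY : q Y)
    (hμ : μ X < (1 + γ) * CompleteType.weight μ p)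
    (hν : ν Y < (1 + γ) * CompleteType.weight ν q) : IsSpecial μ ν γ X Y := by
  obtain ⟨X', Y', hX', hY', h⟩ := exists_homogeneous (F := inst φ) (G := inst (dual φ)) hφ
    (fun a b => Iff.rfl) (fun a b => iff_of_eq (congrFun₂ (relation_dual φ) b a)) p q
  have hp := p.inf_iff.2 ⟨hX, hX'⟩
  have hq := q.inf_iff.2 ⟨hY, hY'⟩
  refine ⟨X ⊓ X', Y ⊓ Y', inf_le_left, inf_le_left, μ.isFinAdd.lt_mul_of_mem hγ hX hμ hp,
    ν.isFinAdd.lt_mul_of_mem hγ hY hν hq, h.imp ?_ ?_⟩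
  · rintro ⟨h1, h2⟩ a ha b hb
    exact ⟨ν.isFinAdd.lt_mul_of_not_mem hγ hY hν (h1 a ha.2),
      μ.isFinAdd.lt_mul_of_not_mem hγ hX hμ (h2 b hb.2)⟩
  · rintro ⟨h1, h2⟩ a ha b hb
    exact ⟨ν.isFinAdd.lt_mul_of_mem hγ hY hν (q.inf_iff.2 ⟨hY, h1 a ha.2⟩),
      μ.isFinAdd.lt_mul_of_mem hγ hX hμ (p.inf_iff.2 ⟨hX, h2 b hb.2⟩)⟩

end Keisler

end StableRegularity

theorem theorem4p1 {L : FirstOrder.Language} {α β : Type*} [Finite α] [Finite β]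
    (T : L.Theory) (φ : L.Formula (α ⊕ β)) (hφ : StableRegularity.IsStable T φ)
    (M : Type*) [L.Structure M] [Nonempty M] (hM : M ⊨ T)
    (μ : StableRegularity.KeislerMeasure M φ)
    (ν : StableRegularity.KeislerMeasure M (StableRegularity.dual φ))
    (ε : ℝ) (hε : 0 < ε) :
    ∃ m n : ℕ, 1 ≤ m ∧ 1 ≤ n ∧ ∀ γ : ℝ, 0 < γ →
      ∃ (X : Fin (m + 1) → StableRegularity.definableSets M φ)
        (Y : Fin (n + 1) → StableRegularity.definableSets M (StableRegularity.dual φ)),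
        StableRegularity.IsPartition (fun i => (X i : Set (α → M))) ∧
        StableRegularity.IsPartition (fun j => (Y j : Set (β → M))) ∧
        μ (X 0) < ε ∧ ν (Y 0) < ε ∧
        ∀ (i : Fin (m + 1)) (j : Fin (n + 1)), i ≠ 0 → j ≠ 0 →
          StableRegularity.IsSpecial μ ν γ (X i) (Y j) := by
  obtain ⟨k, hk⟩ := StableRegularity.exists_not_hasLadder hφ hM
  have hk' : ¬ StableRegularity.HasLadder
      (StableRegularity.relation M (StableRegularity.dual φ)) k := fun h => by
    rw [StableRegularity.relation_dual] at h
    exact hk h.swap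
  obtain ⟨m, p, hm, hp⟩ := StableRegularity.exists_types_partition μ.isFinAdd μ.map_top
    (μ.tsum_weight hk) hε
  obtain ⟨n, q, hn, hq⟩ := StableRegularity.exists_types_partition ν.isFinAdd ν.map_top
    (ν.tsum_weight hk') hε
  refine ⟨m, n, hm, hn, fun γ hγ => ?_⟩
  obtain ⟨X, hXP, hX0, hX⟩ := hp γ hγ
  obtain ⟨Y, hYP, hY0, hY⟩ := hq γ hγ
  refine ⟨X, Y, hXP, hYP, hX0, hY0, fun i j hi hj => ?_⟩
  obtain ⟨i, rfl⟩ := Fin.exists_succ_eq_of_ne_zero hi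
  obtain ⟨j, rfl⟩ := Fin.exists_succ_eq_of_ne_zero hj
  exact StableRegularity.isSpecial_of_types hk μ ν hγ (hX i).1 (hY j).1 (hX i).2 (hY j).2
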